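/- Let $n\in\mathbb N$, let $A=\{1<2<\cdots<n\}$, and let $S_n=\langle A \mid cavb=acvb \ (a,b,c\in A,\ a\le b<c,\ v\in A^*)\rangle$ be the sylvester monoid of rank $n$. Let \[ L=A^*\setminus A^*\{cavb : a,b,c\in A,\ a\le b<c,\ v\in A^*\}A^* \] be the language of words that contain no left-hand side $cavb$ of a defining relation as a factor. Then $(A,L)$ is a biautomatic structure for $S_n$. That is: $A$ is a finite alphabet representing a generating set of $S_n$; $L$ is a regular language; every element of $S_n$ has at least one representative in $L$; and for every $a\in A\cup\{\varepsilon\}$, with \[ L_a=\{(u,v)\in L\times L : ua=_{S_n}v\},\qquad {}_aL=\{(u,v)\in L\times L : au=_{S_n}v\}, \] all four languages $L_a\delta_{\mathrm R}$, ${}_aL\,\delta_{\mathrm R}$, $L_a\delta_{\mathrm L}$ and ${}_aL\,\delta_{\mathrm L}$ are regular over the alphabet $(A\cup\{\$\})\times(A\cup\{\$\})$. Here $\$\notin A$ is a padding symbol; $\delta_{\mathrm R}$ maps a pair $(u,v)$ of words to the word of pairs of symbols obtained by appending symbols $\$$ on the right of the shorter of the two words until the lengths agree and then reading both words in parallel,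 and $\delta_{\mathrm L}$ is defined in the same way with the symbols $\$$ added on the left of the shorter word. -/

import Mathlib

/-! ### Biautomatic structures for monoids -/

/-- The element of the monoid `M` represented by the word `u` over the alphabet `A`, where the
letter `a` represents `f a`. -/
def wordEval {M A : Type*} [Monoid M] (f : A → M) (u : List A) : M :=
  (u.map f).prod

/-- The map `δ_R`: write two words one above the other, aligned on the left, the shorter one being
padded on the right. The padding symbol `$` is `none`, and a letter `a` is `some a`. -/
def padRight {A : Type*} (u v : List A) : List (Option A × Option A) :=
  List.zipWithAll Prod.mk u v

/-- The map `δ_L`: write two words one above the other, aligned on the right, the shorter one being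
padded on the left. -/
def padLeft {A : Type*} (u v : List A) : List (Option A × Option A) :=
  (padRight u.reverse v.reverse).reverse

/-- The language `R δ_R` over `(A ∪ {$}) × (A ∪ {$})`, for a relation `R` on words over `A`. -/
def padRightLanguage {A : Type*} (R : Set (List A × List A)) :
    Language (Option A × Option A) :=
  {w | ∃ u v, (u, v) ∈ R ∧ padRight u v = w}

/-- The language `R δ_L` over `(A ∪ {$}) × (A ∪ {$})`, for a relation `R` on words over `A`. -/
def padLeftLanguage {A : Type*} (R : Set (List A × List A)) :
    Language (Option A × Option A) :=
  {w | ∃ u v, (u, v) ∈ R ∧ padLeft u v = w}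

/-- The relation `L_x` of all pairs `(u, v)` of words in `L` such that `u x` and `v` represent the
same element of the monoid. -/
def rightMulRel {M A : Type*} [Monoid M] (f : A → M) (L : Language A) (x : List A) :
    Set (List A × List A) :=
  {p | p.1 ∈ L ∧ p.2 ∈ L ∧ wordEval f (p.1 ++ x) = wordEval f p.2}

/-- The relation `_x L` of all pairs `(u, v)` of words in `L` such that `x u` and `v` represent the
same element of the monoid. -/
def leftMulRel {M A : Type*} [Monoid M] (f : A → M) (L : Language A) (x : List A) :
    Set (List A × List A) :=
  {p | p.1 ∈ L ∧ p.2 ∈ L ∧ wordEval f (x ++ p.1) = wordEval f p.2}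

/-- `(A, L)` is a biautomatic structure for the monoid `M`, where the letters of `A` represent
elements of `M` through `f`. An element `a` of `A ∪ {ε}` is an `a : Option A`, and `a.toList` is
the corresponding word of length at most one. -/
structure IsBiautomaticStructure {M A : Type*} [Monoid M] (f : A → M) (L : Language A) :
    Prop where
  finite_alphabet : Finite A
  generates : Submonoid.closure (Set.range f) = ⊤
  regular : L.IsRegular
  exists_representative : ∀ m : M, ∃ u ∈ L, wordEval f u = m
  rightMul_padRight : ∀ a : Option A, (padRightLanguage (rightMulRel f L a.toList)).IsRegular
  leftMul_padRight : ∀ a : Option A, (padRightLanguage (leftMulRel f L a.toList)).IsRegular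
  rightMul_padLeft : ∀ a : Option A, (padLeftLanguage (rightMulRel f L a.toList)).IsRegular
  leftMul_padLeft : ∀ a : Option A, (padLeftLanguage (leftMulRel f L a.toList)).IsRegular

/-! ### The sylvester monoid -/

/-- The defining relations `(cavb, acvb)` of the sylvester monoid of rank `n`, where
`a ≤ b < c` are letters and `v` is a word over the ordered alphabet `Fin n`. -/
inductive SylvesterRel (n : ℕ) : FreeMonoid (Fin n) → FreeMonoid (Fin n) → Prop
  | intro (a b c : Fin n) (v : FreeMonoid (Fin n)) (hab : a ≤ b) (hbc : b < c) :
      SylvesterRel n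
        (FreeMonoid.of c * FreeMonoid.of a * v * FreeMonoid.of b)
        (FreeMonoid.of a * FreeMonoid.of c * v * FreeMonoid.of b)

/-- The sylvester monoid `S_n` of rank `n`. -/
abbrev SylvesterMonoid (n : ℕ) : Type :=
  PresentedMonoid (SylvesterRel n)

/-- The canonical map from the alphabet to the sylvester monoid. -/
def sylvesterGen (n : ℕ) : Fin n → SylvesterMonoid n :=
  PresentedMonoid.of (SylvesterRel n)

/-- The language of all words that have no factor `cavb` with `a ≤ b < c` letters and `v` a
word. -/
def sylvesterNormalForms (n : ℕ) : Language (Fin n) :=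
  {w | ∀ (a b c : Fin n) (v : List (Fin n)), a ≤ b → b < c →
    ¬ ([c, a] ++ v ++ [b]) <:+: w}

/-! Words in `L` are unique representatives, and multiplying one of them by a letter alters it by a
bounded number of moves that a finite automaton can check.

Uniqueness: insert the letters of a word from right to left into a binary search tree and read the
tree in postorder. The result is invariant under the defining relations (`sylvesterNF_rel`), and
words of `L` are fixed by it (`sylvesterNF_reverse_of_mem`), since avoiding the factors `cavb`
amounts to avoiding them as subsequences `c a b`.

Moves: in a `SylvesterSlide` one letter crosses a block, every exchange being licensed by the same
later letter. This is a delay of one letter, hence regular. Right multiplication of `u` by `a` puts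
the letters of `u` that are `≤ a` before those that are `> a`. At most `n` slides do this, because
the letters `≤ a` that follow a larger letter are distinct. Left multiplication takes at most one
slide, read backwards (`exists_sylvesterStep_cons`).

All these relations preserve length, so their composites stay synchronously regular. The single
padding symbol is absorbed by one further composition (`isRegular_padded_of_syncRegular`). -/

/-! ### Closure properties of regular languages -/

namespace Language

variable {α β : Type*}

/-- A language that belongs to a finite family of languages closed under taking left quotients by
letters is regular. -/
theorem IsRegular.of_finite_family {L : Language α} (F : Set (Language α)) (hF : F.Finite)
    (hL : L ∈ F) (hstep : ∀ K ∈ F, ∀ a, K.leftQuotient [a] ∈ F) : L.IsRegular := by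
  refine IsRegular.of_finite_range_leftQuotient (hF.subset ?_)
  rintro _ ⟨x, rfl⟩
  induction x using List.reverseRecOn with
  | nil => exact hL
  | append_singleton x a ih => rw [leftQuotient_append]; exact hstep _ ih a

theorem IsRegular.congr {L M : Language α} (h : L.IsRegular) (hLM : ∀ w, w ∈ L ↔ w ∈ M) :
    M.IsRegular := by
  obtain rfl : L = M := Set.ext hLM
  exact h

theorem leftQuotient_mem_range {L K : Language α} (hK : K ∈ Set.range L.leftQuotient) (a : α) :
    K.leftQuotient [a] ∈ Set.range L.leftQuotient := by
  obtain ⟨x, rfl⟩ := hK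
  exact ⟨x ++ [a], leftQuotient_append ..⟩

theorem IsRegular.comap {L : Language β} (h : L.IsRegular) (f : α → β) :
    Language.IsRegular ({w | w.map f ∈ L} : Language α) := by
  obtain ⟨σ, _, M, rfl⟩ := h
  exact ⟨σ, inferInstance, M.comap f, M.accepts_comap f⟩

theorem IsRegular.zero : (0 : Language α).IsRegular :=
  .of_finite_family {0} (Set.finite_singleton _) rfl (by rintro K rfl a; rfl)

/-- Subset construction: a state is a set of left quotients of `L`, one for each possible preimage
of the letters read so far. -/
theorem IsRegular.map {L : Language α} (h : L.IsRegular) (f : α → β) :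
    Language.IsRegular ({w | ∃ u ∈ L, u.map f = w} : Language β) := by
  let G : Set (Language α) → Language β := fun T => {w | ∃ K ∈ T, ∃ u ∈ K, u.map f = w}
  refine .of_finite_family (G '' 𝒫 (Set.range L.leftQuotient))
    (h.finite_range_leftQuotient.finite_subsets.image G)
    ⟨{L}, by simpa using ⟨[], rfl⟩, ?_⟩ ?_
  · ext w
    constructor
    · rintro ⟨_, rfl, hw⟩; exact hw
    · exact fun hw => ⟨L, rfl, hw⟩
  · rintro _ ⟨T, hT, rfl⟩ b
    refine ⟨{K | ∃ J ∈ T, ∃ a, f a = b ∧ K = J.leftQuotient [a]}, ?_, ?_⟩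
    · rintro _ ⟨J, hJ, a, -, rfl⟩
      exact leftQuotient_mem_range (hT hJ) a
    · ext w
      constructor
      · rintro ⟨_, ⟨J, hJ, a, rfl, rfl⟩, u, hu, rfl⟩
        exact ⟨J, hJ, a :: u, hu, rfl⟩
      · rintro ⟨J, hJ, u, hu, huw⟩
        obtain ⟨a, v, rfl, rfl, rfl⟩ := List.map_eq_cons_iff.1 huw
        exact ⟨_, ⟨J, hJ, a, rfl, rfl⟩, v, hu, rfl⟩

/-- A state pairs the quotient of `L` in which no cut has yet been made with the set of quotients of
`M` arising from earlier cuts. -/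
theorem IsRegular.mul {L M : Language α} (hL : L.IsRegular) (hM : M.IsRegular) :
    (L * M).IsRegular := by
  let G : Language α × Set (Language α) → Language α :=
    fun p => {w | w ∈ p.1 * M ∨ ∃ K ∈ p.2, w ∈ K}
  refine .of_finite_family (G '' (Set.range L.leftQuotient ×ˢ 𝒫 (Set.range M.leftQuotient)))
    ((hL.finite_range_leftQuotient.prod hM.finite_range_leftQuotient.finite_subsets).image G)
    ⟨(L, ∅), ⟨⟨[], rfl⟩, by simp⟩, ?_⟩ ?_
  · ext w
    constructor
    · rintro (h | ⟨_, h, _⟩)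
      · exact h
      · exact h.elim
    · exact fun h => Or.inl h
  · rintro _ ⟨⟨K, T⟩, ⟨hK, hT⟩, rfl⟩ a
    refine ⟨(K.leftQuotient [a],
      {J | ([] ∈ K ∧ J = M.leftQuotient [a]) ∨ ∃ N ∈ T, J = N.leftQuotient [a]}),
      ⟨leftQuotient_mem_range hK a, ?_⟩, ?_⟩
    · rintro _ (⟨-, rfl⟩ | ⟨N, hN, rfl⟩)
      · exact ⟨[a], rfl⟩
      · exact leftQuotient_mem_range (hT hN) a
    · ext w
      constructor
      · rintro (h | ⟨_, ⟨hK, rfl⟩ | ⟨N, hN, rfl⟩, hw⟩)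
        · obtain ⟨u, hu, v, hv, rfl⟩ := mem_mul.1 h
          exact Or.inl (mem_mul.2 ⟨a :: u, hu, v, hv, rfl⟩)
        · exact Or.inl (mem_mul.2 ⟨[], hK, a :: w, hw, rfl⟩)
        · exact Or.inr ⟨N, hN, hw⟩
      · rintro (h | ⟨N, hN, hw⟩)
        · obtain ⟨u, hu, v, hv, huv⟩ := mem_mul.1 h
          rcases u with _ | ⟨x, u⟩
          · obtain rfl : v = a :: w := huv
            exact Or.inr ⟨_, Or.inl ⟨hu, rfl⟩, hv⟩
          · obtain ⟨rfl, rfl⟩ : x = a ∧ u ++ v = w := List.cons_eq_cons.1 huv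
            exact Or.inl (mem_mul.2 ⟨u, hu, v, hv, rfl⟩)
        · exact Or.inr ⟨_, Or.inr ⟨N, hN, rfl⟩, hw⟩

theorem IsRegular.forall_mem (P : α → Prop) :
    Language.IsRegular ({w | ∀ a ∈ w, P a} : Language α) := by
  let K₀ : Language α := {w | ∀ a ∈ w, P a}
  refine .of_finite_family {K₀, 0} (Set.toFinite _) (Or.inl rfl) ?_
  rintro K (rfl | rfl) a
  · by_cases ha : P a
    · left
      ext w
      change (∀ b ∈ a :: w, P b) ↔ ∀ b ∈ w, P b
      simp [ha]
    · right
      ext w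
      change (∀ b ∈ a :: w, P b) ↔ False
      simp [ha]
  · exact Or.inr rfl

theorem IsRegular.singleton (a : α) : Language.IsRegular ({[a]} : Language α) := by
  refine .of_finite_family {{[a]}, {[]}, 0} (Set.toFinite _) (Or.inl rfl) ?_
  rintro K (rfl | rfl | rfl) b
  · by_cases h : b = a
    · right; left
      ext w
      change b :: w = [a] ↔ w = []
      simp [h]
    · right; right
      ext w
      change b :: w = [a] ↔ False
      simp [h]
  · right; right
    ext w
    change b :: w = [] ↔ False
    simp
  · exact Or.inr (Or.inr rfl)

theorem IsRegular.exists_of_finite {ι : Type*} [Finite ι] {L : ι → Language α}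
    (h : ∀ i, (L i).IsRegular) : Language.IsRegular ({w | ∃ i, w ∈ L i} : Language α) := by
  classical
  have := Fintype.ofFinite ι
  suffices H : ∀ s : Finset ι, Language.IsRegular ({w | ∃ i ∈ s, w ∈ L i} : Language α) by
    simpa using H Finset.univ
  intro s
  induction s using Finset.induction_on with
  | empty =>
    refine IsRegular.zero.congr fun w => ?_
    change False ↔ ∃ i ∈ (∅ : Finset ι), w ∈ L i
    simp
  | insert i s _ ih =>
    refine ((h i).add ih).congr fun w => ?_
    change (w ∈ L i ∨ ∃ j ∈ s, w ∈ L j) ↔ ∃ j ∈ insert i s, w ∈ L j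
    simp

/-- The state is the one letter that the second track still owes to the first. -/
theorem IsRegular.shift [Finite α] (s t : α) :
    Language.IsRegular
      ({w | s :: w.map Prod.fst = w.map Prod.snd ++ [t]} : Language (α × α)) := by
  let G : α → Language (α × α) := fun s => {w | s :: w.map Prod.fst = w.map Prod.snd ++ [t]}
  refine .of_finite_family (Set.range G ∪ {0}) (Set.toFinite _) (Or.inl ⟨s, rfl⟩) ?_
  rintro K (⟨s, rfl⟩ | rfl) ⟨x, y⟩
  · by_cases h : s = y
    · left
      refine ⟨x, ?_⟩
      ext w
      change (x :: w.map Prod.fst = w.map Prod.snd ++ [t]) ↔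
        (s :: x :: w.map Prod.fst = y :: (w.map Prod.snd ++ [t]))
      simp [h]
    · right
      ext w
      change (s :: x :: w.map Prod.fst = y :: (w.map Prod.snd ++ [t])) ↔ False
      simp [h]
  · exact Or.inr rfl

end Language

/-! ### Synchronously regular relations -/

/-- A relation between words is synchronously regular if it relates only words of equal lengths
and the language of the pairs of related words, read in parallel, is regular. -/
def SyncRegular {α β : Type*} (R : List α → List β → Prop) : Prop :=
  ∃ K : Language (α × β), K.IsRegular ∧
    ∀ u v, R u v ↔ ∃ w ∈ K, w.map Prod.fst = u ∧ w.map Prod.snd = v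

namespace SyncRegular

variable {α β γ : Type*} {R : List α → List β → Prop}

theorem eq_of_map_fst_snd_eq {w w' : List (α × β)} (h₁ : w.map Prod.fst = w'.map Prod.fst)
    (h₂ : w.map Prod.snd = w'.map Prod.snd) : w = w' := by
  rw [← List.zip_unzip w, ← List.zip_unzip w', List.unzip_eq_map, List.unzip_eq_map, h₁, h₂]

theorem isRegular (h : SyncRegular R) :
    Language.IsRegular ({w | R (w.map Prod.fst) (w.map Prod.snd)} : Language (α × β)) := by
  obtain ⟨K, hK, hR⟩ := h
  refine hK.congr fun w => Iff.trans ?_ (hR _ _).symm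
  constructor
  · exact fun hw => ⟨w, hw, rfl, rfl⟩
  · rintro ⟨w', hw', h₁, h₂⟩
    rwa [← eq_of_map_fst_snd_eq h₁ h₂]

/-- Both relations are checked on a three-track word, and the middle track is then projected away.
Equality of lengths is what lets the two witnesses be merged. -/
theorem comp {S : List β → List γ → Prop} (hR : SyncRegular R) (hS : SyncRegular S) :
    SyncRegular (Relation.Comp R S) := by
  obtain ⟨K, hK, hR⟩ := hR
  obtain ⟨J, hJ, hS⟩ := hS
  refine ⟨_, ((hK.comap (fun p : α × β × γ => (p.1, p.2.1))).inf
    (hJ.comap (fun p : α × β × γ => p.2))).map (fun p => (p.1, p.2.2)), fun u v => ?_⟩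
  constructor
  · rintro ⟨y, h₁, h₂⟩
    obtain ⟨w₁, hw₁, rfl, rfl⟩ := (hR _ _).1 h₁
    obtain ⟨w₂, hw₂, hy, rfl⟩ := (hS _ _).1 h₂
    have key : ∀ (w₁ : List (α × β)) (w₂ : List (β × γ)), w₂.map Prod.fst = w₁.map Prod.snd →
        ∃ t : List (α × β × γ), t.map (fun p => (p.1, p.2.1)) = w₁ ∧ t.map (fun p => p.2) = w₂ := by
      intro w₁
      induction w₁ with
      | nil => intro w₂ h; exact ⟨[], rfl, by simpa using h.symm⟩
      | cons p w₁ ih =>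
        rintro (_ | ⟨q, w₂⟩) h
        · simp at h
        · simp only [List.map_cons, List.cons.injEq] at h
          obtain ⟨t, rfl, rfl⟩ := ih w₂ h.2
          exact ⟨(p.1, q) :: t, by simp [h.1], rfl⟩
    obtain ⟨t, rfl, rfl⟩ := key w₁ w₂ hy
    refine ⟨_, ⟨t, ⟨hw₁, hw₂⟩, rfl⟩, ?_, ?_⟩ <;> simp [Function.comp_def]
  · rintro ⟨_, ⟨t, ⟨h₁, h₂⟩, rfl⟩, rfl, rfl⟩
    refine ⟨t.map (fun p => p.2.1), (hR _ _).2 ⟨_, h₁, ?_, ?_⟩, (hS _ _).2 ⟨_, h₂, ?_, ?_⟩⟩ <;>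
      simp [Function.comp_def]

theorem swap (hR : SyncRegular R) : SyncRegular (fun v u => R u v) := by
  obtain ⟨K, hK, hR⟩ := hR
  refine ⟨_, hK.map Prod.swap, fun v u => (hR u v).trans ?_⟩
  constructor
  · rintro ⟨w, hw, rfl, rfl⟩
    exact ⟨_, ⟨w, hw, rfl⟩, by simp [Function.comp_def], by simp [Function.comp_def]⟩
  · rintro ⟨_, ⟨w, hw, rfl⟩, rfl, rfl⟩
    exact ⟨w, hw, by simp [Function.comp_def], by simp [Function.comp_def]⟩

theorem or {S : List α → List β → Prop} (hR : SyncRegular R) (hS : SyncRegular S) :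
    SyncRegular (fun u v => R u v ∨ S u v) := by
  obtain ⟨K, hK, hR⟩ := hR
  obtain ⟨J, hJ, hS⟩ := hS
  refine ⟨_, hK.add hJ, fun u v => ?_⟩
  simp only [hR, hS, Language.mem_add, or_and_right, exists_or]

theorem exists_of_finite {ι : Type*} [Finite ι] {R : ι → List α → List β → Prop}
    (hR : ∀ i, SyncRegular (R i)) : SyncRegular (fun u v => ∃ i, R i u v) := by
  choose K hK hR using hR
  refine ⟨_, Language.IsRegular.exists_of_finite hK, fun u v => ?_⟩
  simp only [hR]
  constructor
  · rintro ⟨i, w, hw, h⟩; exact ⟨w, ⟨i, hw⟩, h⟩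
  · rintro ⟨w, ⟨i, hw⟩, h⟩; exact ⟨i, w, hw, h⟩

theorem append {S : List α → List β → Prop} (hR : SyncRegular R) (hS : SyncRegular S) :
    SyncRegular (fun u v => ∃ u₁ v₁ u₂ v₂, R u₁ v₁ ∧ S u₂ v₂ ∧ u₁ ++ u₂ = u ∧ v₁ ++ v₂ = v) := by
  obtain ⟨K, hK, hR⟩ := hR
  obtain ⟨J, hJ, hS⟩ := hS
  refine ⟨_, hK.mul hJ, fun u v => ?_⟩
  simp only [hR, hS]
  constructor
  · rintro ⟨_, _, _, _, ⟨w₁, h₁, rfl, rfl⟩, ⟨w₂, h₂, rfl, rfl⟩, rfl, rfl⟩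
    exact ⟨w₁ ++ w₂, Language.mem_mul.2 ⟨_, h₁, _, h₂, rfl⟩, by simp, by simp⟩
  · rintro ⟨w, hw, rfl, rfl⟩
    obtain ⟨w₁, h₁, w₂, h₂, rfl⟩ := Language.mem_mul.1 hw
    exact ⟨_, _, _, _, ⟨w₁, h₁, rfl, rfl⟩, ⟨w₂, h₂, rfl, rfl⟩, by simp, by simp⟩

theorem restrict_left (hR : SyncRegular R) {L : Language α} (hL : L.IsRegular) :
    SyncRegular (fun u v => u ∈ L ∧ R u v) := by
  obtain ⟨K, hK, hR⟩ := hR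
  refine ⟨_, (hL.comap Prod.fst).inf hK, fun u v => ⟨?_, ?_⟩⟩
  · rintro ⟨h, hRuv⟩
    obtain ⟨w, hw, rfl, rfl⟩ := (hR _ _).1 hRuv
    exact ⟨w, ⟨h, hw⟩, rfl, rfl⟩
  · rintro ⟨w, ⟨h, hw⟩, rfl, rfl⟩
    exact ⟨h, (hR _ _).2 ⟨w, hw, rfl, rfl⟩⟩

/-- The graph of the letter-to-letter map given by `f`. -/
theorem map (f : α → β) : SyncRegular (fun u v => u.map f = v) := by
  refine ⟨_, (Language.IsRegular.forall_mem (fun _ : α => True)).map (fun a => (a, f a)),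
    fun u v => ?_⟩
  constructor
  · rintro rfl
    exact ⟨_, ⟨u, fun _ _ => trivial, rfl⟩, by simp [Function.comp_def],
      by simp [Function.comp_def]⟩
  · rintro ⟨_, ⟨u, -, rfl⟩, rfl, rfl⟩
    simp [Function.comp_def]

theorem eq : SyncRegular (fun u v : List α => u = v) := by
  simpa using map (id : α → α)

theorem singleton (a : α) (b : β) : SyncRegular (fun u v => u = [a] ∧ v = [b]) := by
  refine ⟨_, Language.IsRegular.singleton (a, b), fun u v => ⟨?_, ?_⟩⟩
  · rintro ⟨rfl, rfl⟩; exact ⟨_, rfl, rfl, rfl⟩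
  · rintro ⟨_, rfl, rfl, rfl⟩; exact ⟨rfl, rfl⟩

theorem shift [Finite α] (s t : α) : SyncRegular (fun u v => s :: u = v ++ [t]) := by
  refine ⟨_, Language.IsRegular.shift s t, fun u v => ⟨fun h => ?_, ?_⟩⟩
  · have hl : u.length = v.length := by simpa using congrArg List.length h
    refine ⟨u.zip v, ?_, List.map_fst_zip hl.le, List.map_snd_zip hl.ge⟩
    change s :: _ = _ ++ [t]
    rw [List.map_fst_zip hl.le, List.map_snd_zip hl.ge, h]
  · rintro ⟨w, hw, rfl, rfl⟩; exact hw

end SyncRegular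

/-- The iterates of a relation. -/
def relPow {X : Type*} (R : X → X → Prop) : ℕ → X → X → Prop
  | 0 => Eq
  | k + 1 => Relation.Comp R (relPow R k)

theorem SyncRegular.relPow {α : Type*} {R : List α → List α → Prop} (hR : SyncRegular R) (k : ℕ) :
    SyncRegular (relPow R k) := by
  induction k with
  | zero => exact SyncRegular.eq
  | succ k ih => exact hR.comp ih

theorem relPow_mono {X : Type*} {R : X → X → Prop} (hR : ∀ x, R x x) {k m : ℕ} (hkm : k ≤ m)
    {x y : X} (h : relPow R k x y) : relPow R m x y := by
  induction hkm with
  | refl => exact h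
  | step _ ih => exact ⟨x, hR x, ih⟩

theorem relPow_le {X : Type*} {R : X → X → Prop} {S : X → X → Prop} (hrefl : ∀ x, S x x)
    (htrans : ∀ x y z, S x y → S y z → S x z) (h : ∀ x y, R x y → S x y) {k : ℕ} {x y : X}
    (hxy : relPow R k x y) : S x y := by
  induction k generalizing x with
  | zero => obtain rfl := hxy; exact hrefl _
  | succ k ih =>
    obtain ⟨z, hxz, hzy⟩ := hxy
    exact htrans _ _ _ (h _ _ hxz) (ih hzy)

/-! ### Padded languages of multiplication relations -/

section Padding

variable {A : Type*}

theorem padRight_eq_iff_of_length_eq {u v : List A} (h : v.length = u.length)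
    (w : List (Option A × Option A)) :
    padRight u v = w ↔ w.map Prod.fst = u.map some ∧ w.map Prod.snd = v.map some := by
  induction u generalizing v w with
  | nil =>
    obtain rfl : v = [] := List.length_eq_zero_iff.1 h
    cases w <;> simp [padRight]
  | cons a u ih =>
    rcases v with _ | ⟨b, v⟩
    · simp at h
    · have ih := ih (v := v) (by simpa using h)
      unfold padRight at ih ⊢
      rcases w with _ | ⟨⟨x, y⟩, w⟩
      · simp
      · simp only [List.zipWithAll_cons_cons, List.cons.injEq, Prod.mk.injEq, List.map_cons, ih,
          eq_comm (a := x), eq_comm (a := y)]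
        tauto

theorem padRight_eq_iff {u v : List A} (h : v.length = u.length + 1)
    (w : List (Option A × Option A)) :
    padRight u v = w ↔ w.map Prod.fst = u.map some ++ [none] ∧ w.map Prod.snd = v.map some := by
  induction u generalizing v w with
  | nil =>
    obtain ⟨b, rfl⟩ := List.length_eq_one_iff.1 h
    rcases w with _ | ⟨⟨x, y⟩, _ | ⟨q, w⟩⟩ <;> simp [padRight]
    grind
  | cons a u ih =>
    rcases v with _ | ⟨b, v⟩
    · simp at h
    · have ih := ih (v := v) (by simpa using h)
      unfold padRight at ih ⊢
      rcases w with _ | ⟨⟨x, y⟩, w⟩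
      · simp
      · simp only [List.zipWithAll_cons_cons, List.cons.injEq, Prod.mk.injEq, List.map_cons,
          List.cons_append, ih, eq_comm (a := x), eq_comm (a := y)]
        tauto

theorem padLeft_eq_iff_of_length_eq {u v : List A} (h : v.length = u.length)
    (w : List (Option A × Option A)) :
    padLeft u v = w ↔ w.map Prod.fst = u.map some ∧ w.map Prod.snd = v.map some := by
  rw [padLeft, List.reverse_eq_iff, padRight_eq_iff_of_length_eq (by simpa using h)]
  simp only [List.map_reverse, List.reverse_inj]

theorem padLeft_eq_iff {u v : List A} (h : v.length = u.length + 1)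
    (w : List (Option A × Option A)) :
    padLeft u v = w ↔ w.map Prod.fst = none :: u.map some ∧ w.map Prod.snd = v.map some := by
  rw [padLeft, List.reverse_eq_iff, padRight_eq_iff (by simpa using h)]
  simp only [List.map_reverse, List.reverse_inj, ← List.reverse_cons]

variable {L : Language A}

theorem SyncRegular.padEnd_append (hL : L.IsRegular) (a : A) :
    SyncRegular (fun x y => ∃ u ∈ L, x = u.map some ++ [none] ∧ y = u ++ [a]) := by
  convert (((SyncRegular.map (some : A → Option A)).restrict_left hL).swap).append
    (SyncRegular.singleton none a) using 3 with x y
  constructor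
  · rintro ⟨u, hu, rfl, rfl⟩
    exact ⟨_, u, _, _, ⟨hu, rfl⟩, ⟨rfl, rfl⟩, rfl, rfl⟩
  · rintro ⟨_, u, _, _, ⟨hu, rfl⟩, ⟨rfl, rfl⟩, rfl, rfl⟩
    exact ⟨u, hu, rfl, rfl⟩

theorem SyncRegular.padStart_cons (hL : L.IsRegular) (a : A) :
    SyncRegular (fun x y => ∃ u ∈ L, x = none :: u.map some ∧ y = a :: u) := by
  convert (SyncRegular.singleton none a).append
    (((SyncRegular.map (some : A → Option A)).restrict_left hL).swap) using 3 with x y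
  constructor
  · rintro ⟨u, hu, rfl, rfl⟩
    exact ⟨_, _, _, u, ⟨rfl, rfl⟩, ⟨hu, rfl⟩, rfl, rfl⟩
  · rintro ⟨_, _, _, u, ⟨rfl, rfl⟩, ⟨hu, rfl⟩, rfl, rfl⟩
    exact ⟨u, hu, rfl, rfl⟩

/-- Here padding and new letter sit at opposite ends. The shift carries `a` from the end of `u ++
[a]` to its front. -/
theorem SyncRegular.padEnd_cons [Finite A] (hL : L.IsRegular) (a : A) :
    SyncRegular (fun x y => ∃ u ∈ L, x = u.map some ++ [none] ∧ y = a :: u) := by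
  convert (SyncRegular.padEnd_append hL a).comp (SyncRegular.shift a a) using 3 with x y
  constructor
  · rintro ⟨u, hu, rfl, rfl⟩
    exact ⟨_, ⟨u, hu, rfl, rfl⟩, rfl⟩
  · rintro ⟨_, ⟨u, hu, rfl, rfl⟩, h⟩
    exact ⟨u, hu, rfl, (List.append_cancel_right (as := a :: u) h).symm⟩

theorem SyncRegular.padStart_append [Finite A] (hL : L.IsRegular) (a : A) :
    SyncRegular (fun x y => ∃ u ∈ L, x = none :: u.map some ∧ y = u ++ [a]) := by
  convert (SyncRegular.padStart_cons hL a).comp (SyncRegular.shift a a).swap using 3 with x y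
  constructor
  · rintro ⟨u, hu, rfl, rfl⟩
    exact ⟨_, ⟨u, hu, rfl, rfl⟩, rfl⟩
  · rintro ⟨_, ⟨u, hu, rfl, rfl⟩, h⟩
    exact ⟨u, hu, rfl, by simpa using h⟩

variable {M : Type*} [Monoid M] {f : A → M} {S : List A → List A → Prop} {τ : List A → List A}

/-- If `S` is a synchronously regular relation contained in equality in the monoid that relates
`τ u`, for each `u ∈ L`, to its representative in `L`, then the pairs of `u ∈ L` (padded through
`pad`) and the representative of `τ u` form a regular language. -/
theorem isRegular_padded_of_syncRegular (hL : L.IsRegular)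
    (hinj : ∀ u ∈ L, ∀ v ∈ L, wordEval f u = wordEval f v → u = v)
    (hS : SyncRegular S) (hsound : ∀ u v, S u v → wordEval f u = wordEval f v)
    (hcomplete : ∀ u ∈ L, ∃ v ∈ L, S (τ u) v) (pad : List A → List (Option A))
    (hpad : SyncRegular (fun x y => ∃ u ∈ L, x = pad u ∧ y = τ u)) :
    Language.IsRegular ({w | ∃ u v, u ∈ L ∧ v ∈ L ∧ wordEval f (τ u) = wordEval f v ∧
      w.map Prod.fst = pad u ∧ w.map Prod.snd = v.map some} :
        Language (Option A × Option A)) := by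
  refine ((hpad.comp hS).comp
    ((SyncRegular.map (some : A → Option A)).restrict_left hL)).isRegular.congr fun w => ?_
  constructor
  · rintro ⟨v, ⟨_, ⟨u, hu, hx, rfl⟩, hSv⟩, hv, hz⟩
    exact ⟨u, v, hu, hv, hsound _ _ hSv, hx, hz.symm⟩
  · rintro ⟨u, v, hu, hv, huv, hx, hz⟩
    obtain ⟨v', hv', hSv⟩ := hcomplete u hu
    -- `S` need only reach some representative in `L`; uniqueness identifies it with `v`.
    obtain rfl := hinj _ hv' _ hv ((hsound _ _ hSv).symm.trans huv)
    exact ⟨v', ⟨_, ⟨u, hu, hx, rfl⟩, hSv⟩, hv', hz.symm⟩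

/-- A criterion for biautomaticity with unique representatives, for monoids in which all words
that represent the same element have the same length. -/
theorem isBiautomaticStructure_of_syncRegular [Finite A]
    (hgen : Submonoid.closure (Set.range f) = ⊤) (hL : L.IsRegular)
    (hrep : ∀ m : M, ∃ u ∈ L, wordEval f u = m)
    (hinj : ∀ u ∈ L, ∀ v ∈ L, wordEval f u = wordEval f v → u = v)
    (hlen : ∀ u v, wordEval f u = wordEval f v → u.length = v.length)
    (hS : SyncRegular S) (hsound : ∀ u v, S u v → wordEval f u = wordEval f v)
    (hright : ∀ a, ∀ u ∈ L, ∃ v ∈ L, S (u ++ [a]) v)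
    (hleft : ∀ a, ∀ u ∈ L, ∃ v ∈ L, S (a :: u) v) :
    IsBiautomaticStructure f L := by
  -- Multiplication by the empty word needs no padding, so one language serves all four cases.
  have hdiag : Language.IsRegular ({w | ∃ u v, u ∈ L ∧ v ∈ L ∧ wordEval f u = wordEval f v ∧
      w.map Prod.fst = u.map some ∧ w.map Prod.snd = v.map some} :
        Language (Option A × Option A)) := by
    refine isRegular_padded_of_syncRegular (τ := id) hL hinj SyncRegular.eq (by rintro u _ rfl; rfl)
      (fun u hu => ⟨u, hu, rfl⟩) (List.map some) ?_
    convert ((SyncRegular.map (some : A → Option A)).restrict_left hL).swap using 3 with x y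
    constructor
    · rintro ⟨u, hu, rfl, rfl⟩; exact ⟨hu, rfl⟩
    · rintro ⟨hy, rfl⟩; exact ⟨y, hy, rfl, rfl⟩
  refine ⟨inferInstance, hgen, hL, hrep, ?_, ?_, ?_, ?_⟩
  · rintro (_ | a)
    · refine hdiag.congr fun w => ⟨?_, ?_⟩
      · rintro ⟨u, v, hu, hv, huv, h⟩
        exact ⟨u, v, ⟨hu, hv, by simpa using huv⟩,
          (padRight_eq_iff_of_length_eq (hlen _ _ huv).symm w).2 h⟩
      · rintro ⟨u, v, ⟨hu, hv, huv⟩, h⟩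
        replace huv : wordEval f u = wordEval f v := by simpa using huv
        exact ⟨u, v, hu, hv, huv, (padRight_eq_iff_of_length_eq (hlen _ _ huv).symm w).1 h⟩
    · refine (isRegular_padded_of_syncRegular hL hinj hS hsound (hright a) _
        (SyncRegular.padEnd_append hL a)).congr fun w => ⟨?_, ?_⟩
      · rintro ⟨u, v, hu, hv, huv, h⟩
        exact ⟨u, v, ⟨hu, hv, huv⟩, (padRight_eq_iff (by simpa using (hlen _ _ huv).symm) w).2 h⟩
      · rintro ⟨u, v, ⟨hu, hv, huv⟩, h⟩
        exact ⟨u, v, hu, hv, huv, (padRight_eq_iff (by simpa using (hlen _ _ huv).symm) w).1 h⟩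
  · rintro (_ | a)
    · refine hdiag.congr fun w => ⟨?_, ?_⟩
      · rintro ⟨u, v, hu, hv, huv, h⟩
        exact ⟨u, v, ⟨hu, hv, huv⟩, (padRight_eq_iff_of_length_eq (hlen _ _ huv).symm w).2 h⟩
      · rintro ⟨u, v, ⟨hu, hv, huv⟩, h⟩
        exact ⟨u, v, hu, hv, huv, (padRight_eq_iff_of_length_eq (hlen _ _ huv).symm w).1 h⟩
    · refine (isRegular_padded_of_syncRegular hL hinj hS hsound (hleft a) _
        (SyncRegular.padEnd_cons hL a)).congr fun w => ⟨?_, ?_⟩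
      · rintro ⟨u, v, hu, hv, huv, h⟩
        exact ⟨u, v, ⟨hu, hv, huv⟩, (padRight_eq_iff (by simpa using (hlen _ _ huv).symm) w).2 h⟩
      · rintro ⟨u, v, ⟨hu, hv, huv⟩, h⟩
        exact ⟨u, v, hu, hv, huv, (padRight_eq_iff (by simpa using (hlen _ _ huv).symm) w).1 h⟩
  · rintro (_ | a)
    · refine hdiag.congr fun w => ⟨?_, ?_⟩
      · rintro ⟨u, v, hu, hv, huv, h⟩
        exact ⟨u, v, ⟨hu, hv, by simpa using huv⟩,
          (padLeft_eq_iff_of_length_eq (hlen _ _ huv).symm w).2 h⟩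
      · rintro ⟨u, v, ⟨hu, hv, huv⟩, h⟩
        replace huv : wordEval f u = wordEval f v := by simpa using huv
        exact ⟨u, v, hu, hv, huv, (padLeft_eq_iff_of_length_eq (hlen _ _ huv).symm w).1 h⟩
    · refine (isRegular_padded_of_syncRegular hL hinj hS hsound (hright a) _
        (SyncRegular.padStart_append hL a)).congr fun w => ⟨?_, ?_⟩
      · rintro ⟨u, v, hu, hv, huv, h⟩
        exact ⟨u, v, ⟨hu, hv, huv⟩, (padLeft_eq_iff (by simpa using (hlen _ _ huv).symm) w).2 h⟩
      · rintro ⟨u, v, ⟨hu, hv, huv⟩, h⟩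
        exact ⟨u, v, hu, hv, huv, (padLeft_eq_iff (by simpa using (hlen _ _ huv).symm) w).1 h⟩
  · rintro (_ | a)
    · refine hdiag.congr fun w => ⟨?_, ?_⟩
      · rintro ⟨u, v, hu, hv, huv, h⟩
        exact ⟨u, v, ⟨hu, hv, huv⟩, (padLeft_eq_iff_of_length_eq (hlen _ _ huv).symm w).2 h⟩
      · rintro ⟨u, v, ⟨hu, hv, huv⟩, h⟩
        exact ⟨u, v, hu, hv, huv, (padLeft_eq_iff_of_length_eq (hlen _ _ huv).symm w).1 h⟩
    · refine (isRegular_padded_of_syncRegular hL hinj hS hsound (hleft a) _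
        (SyncRegular.padStart_cons hL a)).congr fun w => ⟨?_, ?_⟩
      · rintro ⟨u, v, hu, hv, huv, h⟩
        exact ⟨u, v, ⟨hu, hv, huv⟩, (padLeft_eq_iff (by simpa using (hlen _ _ huv).symm) w).2 h⟩
      · rintro ⟨u, v, ⟨hu, hv, huv⟩, h⟩
        exact ⟨u, v, hu, hv, huv, (padLeft_eq_iff (by simpa using (hlen _ _ huv).symm) w).1 h⟩

end Padding

/-! ### Normal forms of the sylvester monoid -/

section Sylvester

variable {n : ℕ}

theorem wordEval_append {M A : Type*} [Monoid M] (f : A → M) (u v : List A) :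
    wordEval f (u ++ v) = wordEval f u * wordEval f v := by
  simp [wordEval]

theorem wordEval_cons {M A : Type*} [Monoid M] (f : A → M) (a : A) (u : List A) :
    wordEval f (a :: u) = f a * wordEval f u := by
  simp [wordEval]

theorem wordEval_congr {M A : Type*} [Monoid M] {f : A → M} {u v : List A} (p q : List A)
    (h : wordEval f u = wordEval f v) :
    wordEval f (p ++ u ++ q) = wordEval f (p ++ v ++ q) := by
  simp only [wordEval_append, h]

theorem wordEval_sylvesterGen (u : List (Fin n)) :
    wordEval (sylvesterGen n) u = PresentedMonoid.mk (SylvesterRel n) (FreeMonoid.ofList u) := by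
  induction u with
  | nil => rfl
  | cons a u ih => rw [wordEval_cons, ih]; rfl

theorem wordEval_sylvesterGen_eq_iff (u v : List (Fin n)) :
    wordEval (sylvesterGen n) u = wordEval (sylvesterGen n) v ↔
      conGen (SylvesterRel n) (FreeMonoid.ofList u) (FreeMonoid.ofList v) := by
  rw [wordEval_sylvesterGen, wordEval_sylvesterGen, PresentedMonoid.mk_eq_mk_iff]

theorem wordEval_sylvesterGen_rel {a b c : Fin n} (v : List (Fin n)) (hab : a ≤ b) (hbc : b < c) :
    wordEval (sylvesterGen n) (c :: a :: v ++ [b]) =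
      wordEval (sylvesterGen n) (a :: c :: v ++ [b]) :=
  (wordEval_sylvesterGen_eq_iff _ _).2 (ConGen.Rel.of _ _ (SylvesterRel.intro a b c v hab hbc))

/-! ### An invariant of the defining relations -/

/-- The normal form of a word of the sylvester monoid, both words being reversed. -/
def sylvesterNF : List (Fin n) → List (Fin n)
  | [] => []
  | a :: w => a :: (sylvesterNF (w.filter (a < ·)) ++ sylvesterNF (w.filter (· ≤ a)))
termination_by w => w.length
decreasing_by
  all_goals
    simp only [List.length_unattach, List.length_cons]
    exact Nat.lt_succ_of_le ((List.length_filter_le _ _).trans_eq List.length_attach)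

/-- If the root is `b`, then `a` and `c` fall into different subtrees and their order is lost. With
an earlier root `x`, a subtree that receives both `a` and `c` also receives `b`, and induction
applies; a subtree missing one of them does not see the exchange. -/
theorem sylvesterNF_rel {a b c : Fin n} (p q v : List (Fin n)) (hab : a ≤ b) (hbc : b < c) :
    sylvesterNF (q ++ b :: v ++ a :: c :: p) = sylvesterNF (q ++ b :: v ++ c :: a :: p) := by
  induction hm : (q ++ b :: v ++ p).length using Nat.strong_induction_on generalizing p q v with
  | _ m ih =>
    rcases q with _ | ⟨x, q⟩
    · simp [sylvesterNF, hab, hbc, hbc.not_ge, hab.not_gt]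
    · have key : ∀ f : Fin n → Bool, (f a → f c → f b) →
          sylvesterNF ((q ++ b :: v ++ a :: c :: p).filter f) =
            sylvesterNF ((q ++ b :: v ++ c :: a :: p).filter f) := by
        intro f hf
        have h := ih (q.filter f ++ b :: v.filter f ++ p.filter f).length (by
          have h₁ := List.length_filter_le f q
          have h₂ := List.length_filter_le f v
          have h₃ := List.length_filter_le f p
          simp at hm ⊢
          omega) (p.filter f) (q.filter f) (v.filter f) rfl
        by_cases ha : f a <;> by_cases hc : f c <;> simp [List.filter_cons, ha, hc]
        simpa [List.filter_cons, hf ha hc] using h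
      have h₁ := key (x < ·) (by simpa using fun h _ => h.trans_le hab)
      have h₂ := key (· ≤ x) (by simpa using fun _ h => hbc.le.trans h)
      simp only [List.cons_append, sylvesterNF] at h₁ h₂ ⊢
      rw [h₁, h₂]

theorem sylvesterNF_eq_of_wordEval_eq {u v : List (Fin n)}
    (h : wordEval (sylvesterGen n) u = wordEval (sylvesterGen n) v) :
    sylvesterNF u.reverse = sylvesterNF v.reverse := by
  -- Quantifying over all contexts makes equality of normal forms a congruence.
  let r : Con (FreeMonoid (Fin n)) :=
    { r := fun u v => ∀ p q : List (Fin n),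
        sylvesterNF (p ++ u.toList ++ q).reverse = sylvesterNF (p ++ v.toList ++ q).reverse
      iseqv := ⟨fun _ _ _ => rfl, fun h p q => (h p q).symm, fun h h' p q => (h p q).trans (h' p q)⟩
      mul' := fun {w x y z} h h' p q => by
        have h₁ := h p (y.toList ++ q)
        have h₂ := h' (p ++ x.toList) q
        simp only [FreeMonoid.toList_mul, List.append_assoc] at h₁ h₂ ⊢
        exact h₁.trans h₂ }
  have hr : conGen (SylvesterRel n) ≤ r := by
    refine Con.conGen_le.2 ?_
    rintro _ _ ⟨a, b, c, v, hab, hbc⟩ p q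
    simpa [FreeMonoid.toList_mul] using
      sylvesterNF_rel p.reverse q.reverse v.toList.reverse hab hbc
  simpa using hr ((wordEval_sylvesterGen_eq_iff u v).1 h) [] []

theorem length_eq_of_wordEval_sylvesterGen_eq {u v : List (Fin n)}
    (h : wordEval (sylvesterGen n) u = wordEval (sylvesterGen n) v) : u.length = v.length := by
  let φ : SylvesterMonoid n →* Multiplicative ℕ :=
    PresentedMonoid.lift (fun _ => Multiplicative.ofAdd 1) (by
      rintro _ _ ⟨a, b, c, v, -, -⟩
      simp only [map_mul, FreeMonoid.lift_eval_of])
  have hφ : ∀ w, φ (wordEval (sylvesterGen n) w) = Multiplicative.ofAdd w.length := by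
    intro w
    induction w with
    | nil => exact map_one φ
    | cons a w ih =>
      rw [wordEval_cons, map_mul, ih, List.length_cons, add_comm, ofAdd_add]
      rfl
  simpa [hφ] using congrArg φ h

/-! ### Forbidden subsequences and uniqueness of normal forms -/

/-- A word is a normal form if and only if it has no subsequence `x y b` with `y ≤ b < x`. -/
theorem mem_sylvesterNormalForms_iff {w : List (Fin n)} :
    w ∈ sylvesterNormalForms n ↔ w.Triplewise (fun x y b => y ≤ b → x ≤ b) := by
  induction w with
  | nil =>
    refine ⟨fun _ => .nil, fun _ a b c v _ _ h => ?_⟩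
    simpa using h.length_le
  | cons x w ih =>
    rw [List.triplewise_cons, ← ih]
    constructor
    · intro h
      have hw : w ∈ sylvesterNormalForms n := fun a b c v hab hbc hinf =>
        h a b c v hab hbc (hinf.trans (List.suffix_cons x w).isInfix)
      refine ⟨?_, hw⟩
      rcases w with _ | ⟨y, w⟩
      · exact .nil
      · have hxy : ∀ b ∈ w, y ≤ b → x ≤ b := by
          intro b hb hyb
          obtain ⟨v, r, rfl⟩ := List.append_of_mem hb
          exact not_lt.1 fun hbx => h y b x v hyb hbx ⟨[], r, by simp⟩
        refine List.pairwise_cons.2 ⟨hxy, ?_⟩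
        -- For a later letter `z ≤ b`, the triple `y z b` gives `y ≤ b`, and then the factor
        -- starting with `x y` gives `x ≤ b`.
        exact (List.triplewise_cons.1 (ih.1 hw)).1.imp_of_mem
          fun _ hb h' hyb => hxy _ hb (h' hyb)
    · rintro ⟨hx, hw⟩ a b c v hab hbc hinf
      rcases List.infix_cons_iff.1 hinf with h | h
      · obtain ⟨rfl, hpre⟩ := List.cons_prefix_cons.1 (h : c :: (a :: v ++ [b]) <+: x :: w)
        have hp := List.Pairwise.sublist hpre.sublist hx
        exact ((List.pairwise_cons.1 hp).1 b (by simp) hab).not_gt hbc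
      · exact hw a b c v hab hbc h

theorem sylvesterNormalForms_sublist {u w : List (Fin n)} (h : u.Sublist w)
    (hw : w ∈ sylvesterNormalForms n) : u ∈ sylvesterNormalForms n := by
  rw [mem_sylvesterNormalForms_iff] at hw ⊢
  induction h with
  | slnil => exact hw
  | cons _ _ ih => exact ih (List.triplewise_cons.1 hw).2
  | cons_cons _ h ih =>
    obtain ⟨h₁, h₂⟩ := List.triplewise_cons.1 hw
    exact List.triplewise_cons.2 ⟨h₁.sublist h, ih h₂⟩

/-- Avoidance of triples ending in the final `a` means that after a letter `> a` only letters `> a`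
occur in `u`. -/
theorem filter_append_filter_eq_of_mem_sylvesterNormalForms {u : List (Fin n)} {a : Fin n}
    (h : u ++ [a] ∈ sylvesterNormalForms n) :
    u.filter (· ≤ a) ++ u.filter (a < ·) = u := by
  rw [mem_sylvesterNormalForms_iff] at h
  replace h : u.Pairwise (fun x y => y ≤ a → x ≤ a) :=
    (List.triplewise_append.1 h).2.2.2 a (by simp)
  induction u with
  | nil => rfl
  | cons x u ih =>
    obtain ⟨hx, hu⟩ := List.pairwise_cons.1 h
    by_cases hxa : x ≤ a
    · simpa [hxa, hxa.not_gt] using ih hu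
    · have h₁ : u.filter (· ≤ a) = [] := List.filter_eq_nil_iff.2 fun y hy => by
        simpa using not_le.1 fun hya => hxa (hx y hy hya)
      have h₂ : u.filter (a < ·) = u := by simpa [h₁] using ih hu
      simp [hxa, not_le.1 hxa, h₁, h₂]

theorem sylvesterNF_reverse_of_mem {w : List (Fin n)} (hw : w ∈ sylvesterNormalForms n) :
    sylvesterNF w.reverse = w.reverse := by
  induction hm : w.length using Nat.strong_induction_on generalizing w with
  | _ m ih =>
    rcases w.eq_nil_or_concat with rfl | ⟨u, a, rfl⟩
    · simp [sylvesterNF]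
    · rw [List.concat_eq_append] at hw hm ⊢
      have hu : ∀ f, sylvesterNF (u.filter f).reverse = (u.filter f).reverse := fun f =>
        ih _ (by simpa [← hm] using Nat.lt_succ_of_le (List.length_filter_le f u))
          (sylvesterNormalForms_sublist (List.filter_sublist.trans (List.sublist_append_left u [a]))
            hw) rfl
      have h := filter_append_filter_eq_of_mem_sylvesterNormalForms hw
      rw [List.reverse_append, List.reverse_singleton, List.singleton_append, sylvesterNF,
        List.filter_reverse, List.filter_reverse, hu, hu, ← List.reverse_append, h]

theorem eq_of_mem_sylvesterNormalForms {u v : List (Fin n)} (hu : u ∈ sylvesterNormalForms n)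
    (hv : v ∈ sylvesterNormalForms n)
    (h : wordEval (sylvesterGen n) u = wordEval (sylvesterGen n) v) : u = v := by
  have := sylvesterNF_eq_of_wordEval_eq h
  rwa [sylvesterNF_reverse_of_mem hu, sylvesterNF_reverse_of_mem hv, List.reverse_inj] at this

/-- This word is the normal form of `u ++ [a]`. A forbidden triple cannot start in the low block and
end outside it, nor have its first two letters in the high block and end in `a`; the others lie
inside a subsequence of `u`. -/
theorem filter_append_filter_append_mem_sylvesterNormalForms {u : List (Fin n)}
    (hu : u ∈ sylvesterNormalForms n) (a : Fin n) :
    u.filter (· ≤ a) ++ u.filter (a < ·) ++ [a] ∈ sylvesterNormalForms n := by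
  have h₁ := sylvesterNormalForms_sublist (List.filter_sublist (p := (· ≤ a))) hu
  have h₂ := sylvesterNormalForms_sublist (List.filter_sublist (p := (a < ·))) hu
  rw [mem_sylvesterNormalForms_iff] at h₁ h₂ ⊢
  have hle : ∀ x ∈ u.filter (· ≤ a), x ≤ a := fun x hx => by simpa using (List.mem_filter.1 hx).2
  have hlt : ∀ x ∈ u.filter (a < ·), a < x := fun x hx => by simpa using (List.mem_filter.1 hx).2
  rw [List.triplewise_append, List.triplewise_append]
  refine ⟨⟨h₁, h₂, fun x hx => ?_, fun z hz => ?_⟩, by simp, fun _ _ => by simp, ?_⟩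
  · exact List.pairwise_of_forall_mem_list fun _ _ b hb _ => (hle x hx).trans (hlt b hb).le
  · exact List.pairwise_of_forall_mem_list fun x hx _ _ _ => (hle x hx).trans (hlt z hz).le
  · simp only [List.mem_singleton, forall_eq]
    refine List.pairwise_append.2 ⟨?_, ?_, ?_⟩
    · exact List.pairwise_of_forall_mem_list fun x hx _ _ _ => hle x hx
    · exact List.pairwise_of_forall_mem_list fun _ _ y hy hya => ((hlt y hy).not_ge hya).elim
    · exact fun x hx _ _ _ => hle x hx

theorem isRegular_sylvesterNormalForms : (sylvesterNormalForms n).IsRegular := by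
  have htop : Language.IsRegular ({w | ∀ x ∈ w, True} : Language (Fin n)) :=
    Language.IsRegular.forall_mem _
  have key : ∀ i : {i : Fin n × Fin n × Fin n // i.1 ≤ i.2.1 ∧ i.2.1 < i.2.2},
      Language.IsRegular ({w | ∃ p v q, p ++ [i.1.2.2, i.1.1] ++ v ++ [i.1.2.1] ++ q = w} :
        Language (Fin n)) := by
    rintro ⟨⟨a, b, c⟩, -⟩
    refine (((((htop.mul (.singleton c)).mul (.singleton a)).mul htop).mul (.singleton b)).mul
      htop).congr fun w => ?_
    constructor
    · rintro ⟨_, ⟨_, ⟨_, ⟨_, ⟨p, -, _, rfl, rfl⟩, _, rfl, rfl⟩, v, -, rfl⟩, _, rfl, rfl⟩, q, -, rfl⟩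
      exact ⟨p, v, q, by simp⟩
    · rintro ⟨p, v, q, rfl⟩
      exact ⟨_, ⟨_, ⟨_, ⟨_, ⟨p, fun _ _ => trivial, _, rfl, rfl⟩, _, rfl, rfl⟩, v,
        fun _ _ => trivial, rfl⟩, _, rfl, rfl⟩, q, fun _ _ => trivial, by simp⟩
  refine (Language.IsRegular.exists_of_finite key).compl.congr fun w => ?_
  constructor
  · rintro h a b c v hab hbc ⟨p, q, rfl⟩
    exact h ⟨⟨(a, b, c), hab, hbc⟩, p, v, q, by simp⟩
  · rintro h ⟨⟨⟨a, b, c⟩, hab, hbc⟩, p, v, q, rfl⟩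
    exact h a b c v hab hbc ⟨p, q, by simp⟩

/-! ### Slides -/

/-- The relation that moves one letter `x` to the left past a block of letters each of which may be
interchanged with `x` because of one and the same letter `b` further to the right. -/
def SylvesterSlide (u v : List (Fin n)) : Prop :=
  ∃ (i : Fin n × Fin n) (p D q r : List (Fin n)),
    (∀ d ∈ D, d = i.2 ∨ (i.2 ≤ i.1 ∧ i.1 < d) ∨ (d ≤ i.1 ∧ i.1 < i.2)) ∧
      u = p ++ (D ++ i.2 :: (q ++ i.1 :: r)) ∧ v = p ++ (i.2 :: (D ++ (q ++ i.1 :: r)))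

theorem syncRegular_sylvesterSlide : SyncRegular (SylvesterSlide (n := n)) := by
  refine SyncRegular.exists_of_finite fun i => ?_
  -- The shift sends `D ++ [x]` to `x :: D`. The letter condition is tested on all of `D ++ [x]`,
  -- hence the alternative `d = x`. The empty word, which the shift relates to itself, has to be
  -- excluded.
  have hD := (SyncRegular.shift i.2 i.2).restrict_left ((Language.IsRegular.forall_mem
    fun d => d = i.2 ∨ (i.2 ≤ i.1 ∧ i.1 < d) ∨ (d ≤ i.1 ∧ i.1 < i.2)).inf
      (Language.IsRegular.forall_mem fun _ => False).compl)
  convert SyncRegular.eq.append (hD.append (SyncRegular.eq.append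
    ((SyncRegular.singleton i.1 i.1).append SyncRegular.eq))) using 3 with u v
  constructor
  · rintro ⟨p, D, q, r, hD, rfl, rfl⟩
    have hD' : ∀ d ∈ D ++ [i.2], d = i.2 ∨ (i.2 ≤ i.1 ∧ i.1 < d) ∨ (d ≤ i.1 ∧ i.1 < i.2) := by
      simpa [or_imp, forall_and] using hD
    have hne : ¬ ∀ d ∈ D ++ [i.2], False := fun h => h i.2 (by simp)
    exact ⟨p, p, _, _, rfl, ⟨D ++ [i.2], i.2 :: D, _, _, ⟨⟨hD', hne⟩, by simp⟩,
      ⟨q, q, _, _, rfl, ⟨_, _, r, r, ⟨rfl, rfl⟩, rfl, rfl, rfl⟩, rfl, rfl⟩,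
      rfl, rfl⟩, by simp, by simp⟩
  · rintro ⟨p, _, _, _, rfl, ⟨s, s', _, _, ⟨⟨hs, hne⟩, hss'⟩, ⟨q, _, _, _, rfl,
      ⟨_, _, r, _, ⟨rfl, rfl⟩, rfl, rfl, rfl⟩, rfl, rfl⟩, rfl, rfl⟩, rfl, rfl⟩
    rcases s' with _ | ⟨x, D⟩
    · obtain rfl : s = [] := by simpa using hss'
      exact (hne (fun _ h => by simp at h)).elim
    · obtain ⟨rfl, rfl⟩ := List.cons_eq_cons.1 hss'
      exact ⟨p, D, q, r, fun d hd => hs d (by simp [hd]), by simp, by simp⟩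

/-- The letter `x` crosses the block from its right end, one defining relation per letter other than
`x`; the licensing letter `b` stays to the right throughout. -/
theorem wordEval_eq_of_sylvesterSlide {u v : List (Fin n)} (h : SylvesterSlide u v) :
    wordEval (sylvesterGen n) u = wordEval (sylvesterGen n) v := by
  obtain ⟨⟨b, x⟩, p, D, q, r, hD, rfl, rfl⟩ := h
  rw [wordEval_append _ p, wordEval_append _ p]
  congr 1
  induction D with
  | nil => rfl
  | cons d D ih =>
    simp only [List.mem_cons, forall_eq_or_imp] at hD
    rw [List.cons_append, wordEval_cons, ih hD.2, ← wordEval_cons]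
    rcases hD.1 with rfl | ⟨hxb, hbd⟩ | ⟨hdb, hbx⟩
    · rfl
    · simpa using wordEval_congr [] r (wordEval_sylvesterGen_rel (D ++ q) hxb hbd)
    · simpa using (wordEval_congr [] r (wordEval_sylvesterGen_rel (D ++ q) hdb hbx)).symm

/-- The reflexive and symmetric closure of `SylvesterSlide`. -/
def SylvesterStep (u v : List (Fin n)) : Prop :=
  SylvesterSlide u v ∨ SylvesterSlide v u ∨ u = v

theorem syncRegular_sylvesterStep : SyncRegular (SylvesterStep (n := n)) :=
  syncRegular_sylvesterSlide.or (syncRegular_sylvesterSlide.swap.or SyncRegular.eq)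

theorem SylvesterStep.refl (u : List (Fin n)) : SylvesterStep u u :=
  Or.inr (Or.inr rfl)

theorem wordEval_eq_of_sylvesterStep {u v : List (Fin n)} (h : SylvesterStep u v) :
    wordEval (sylvesterGen n) u = wordEval (sylvesterGen n) v := by
  rcases h with h | h | rfl
  · exact wordEval_eq_of_sylvesterSlide h
  · exact (wordEval_eq_of_sylvesterSlide h).symm
  · rfl

theorem wordEval_eq_of_relPow_sylvesterStep {k : ℕ} {u v : List (Fin n)}
    (h : relPow SylvesterStep k u v) :
    wordEval (sylvesterGen n) u = wordEval (sylvesterGen n) v :=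
  relPow_le (S := fun u v => wordEval (sylvesterGen n) u = wordEval (sylvesterGen n) v)
    (fun _ => rfl) (fun _ _ _ => Eq.trans) (fun _ _ => wordEval_eq_of_sylvesterStep) h

/-! ### Right multiplication: at most `n` slides -/

/-- Scanning `t`, the block `D` collects the letters `> a`. Each letter `≤ a` that is met crosses
`D` in one slide, licensed by the final `a`. -/
theorem relPow_sylvesterStep_filter (a : Fin n) (t p D : List (Fin n)) (hD : ∀ d ∈ D, a < d) :
    relPow SylvesterStep (t.filter (· ≤ a)).length (p ++ D ++ t ++ [a])
      (p ++ t.filter (· ≤ a) ++ D ++ t.filter (a < ·) ++ [a]) := by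
  induction t generalizing p D with
  | nil => simp [relPow]
  | cons e t ih =>
    by_cases hea : e ≤ a
    · have h := ih (p ++ [e]) D hD
      simp only [List.filter_cons, hea, hea.not_gt, decide_true, decide_false, if_true,
        List.length_cons, relPow]
      refine ⟨_, Or.inl ⟨(a, e), p, D, t, [], fun d hd => Or.inr (Or.inl ⟨hea, hD d hd⟩),
        by simp, rfl⟩, ?_⟩
      simpa using h
    · have hae := not_le.1 hea
      have h := ih p (D ++ [e]) (by simpa [or_imp, forall_and] using ⟨hD, hae⟩)
      simpa [List.filter_cons, hea, hae] using h

/-- A repeated letter `y ≤ a` in `t` would give the forbidden subsequence `d y y`, so the letters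
counted are distinct. This is the source of the exponent `n`. -/
theorem length_filter_le_of_mem_sylvesterNormalForms {a d : Fin n} {t : List (Fin n)} (had : a < d)
    (h : d :: t ∈ sylvesterNormalForms n) : (t.filter (· ≤ a)).length ≤ n := by
  rw [mem_sylvesterNormalForms_iff, List.triplewise_cons] at h
  have hnodup : (t.filter (· ≤ a)).Nodup := by
    refine (h.1.filter _).imp_of_mem fun {x y} _ hy hxy hne => ?_
    have hya : y ≤ a := by simpa using (List.mem_filter.1 hy).2
    exact (hxy hne.le).not_gt (hya.trans_lt had)
  simpa using hnodup.length_le_card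

theorem relPow_sylvesterStep_append_singleton {u : List (Fin n)} (hu : u ∈ sylvesterNormalForms n)
    (a : Fin n) :
    relPow SylvesterStep n (u ++ [a]) (u.filter (· ≤ a) ++ u.filter (a < ·) ++ [a]) := by
  -- The prefix `p` absorbs the initial letters `≤ a`, which need not move; counting starts only at
  -- the first letter `> a`.
  suffices H : ∀ p, relPow SylvesterStep n (p ++ u ++ [a])
      (p ++ u.filter (· ≤ a) ++ u.filter (a < ·) ++ [a]) from H []
  induction u with
  | nil => exact fun p => relPow_mono SylvesterStep.refl (Nat.zero_le n) (by simp [relPow])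
  | cons x u ih =>
    intro p
    by_cases hxa : x ≤ a
    · have h := ih (sylvesterNormalForms_sublist (List.sublist_cons_self x u) hu) (p ++ [x])
      simpa [List.filter_cons, hxa, hxa.not_gt] using h
    · have hax := not_le.1 hxa
      have h := relPow_mono SylvesterStep.refl
        (length_filter_le_of_mem_sylvesterNormalForms hax hu)
        (relPow_sylvesterStep_filter a u p [x] (by simpa using hax))
      simpa [List.filter_cons, hxa, hax] using h

/-! ### Left multiplication: at most one slide -/

/-- The letter `a` moves right past `z` as long as some `b` after `z` has `z ≤ b < a`. The invariant
keeps one such `b` dominating all letters passed, so that a single slide performs the whole move. -/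
theorem exists_insert_mem_sylvesterNormalForms (a : Fin n) (y E : List (Fin n))
    (h : E ++ y ∈ sylvesterNormalForms n)
    (hE : E = [] ∨ ∃ b ∈ y, b < a ∧ ∀ e ∈ E, e ≤ b) :
    ∃ E' y', E' ++ y' = E ++ y ∧ (E' = [] ∨ ∃ b ∈ y', b < a ∧ ∀ e ∈ E', e ≤ b) ∧
      E' ++ a :: y' ∈ sylvesterNormalForms n := by
  induction y generalizing E with
  | nil =>
    obtain rfl : E = [] := by simpa using hE
    exact ⟨[], [], rfl, Or.inl rfl, by simp [mem_sylvesterNormalForms_iff]⟩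
  | cons z y ih =>
    by_cases hz : ∃ b ∈ y, z ≤ b ∧ b < a
    · obtain ⟨b', hb', hzb', hb'a⟩ := hz
      obtain ⟨E', y', h₁, h₂⟩ := ih (E ++ [z]) (by simpa using h) (Or.inr (by
        rcases hE with rfl | ⟨b, hb, hba, hEb⟩
        · exact ⟨b', hb', hb'a, by simpa using hzb'⟩
        -- The larger of the old and new witnesses dominates `E ++ [z]`. If the old one is larger,
        -- it is not `z` itself, as `z ≤ b'`.
        · rcases le_or_gt b b' with hbb' | hbb'
          · refine ⟨b', hb', hb'a, fun e he => ?_⟩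
            rcases List.mem_append.1 he with he | he
            · exact (hEb e he).trans hbb'
            · simpa [List.mem_singleton.1 he] using hzb'
          · rcases List.mem_cons.1 hb with rfl | hb
            · exact absurd hzb' hbb'.not_ge
            · refine ⟨b, hb, hba, fun e he => ?_⟩
              rcases List.mem_append.1 he with he | he
              · exact hEb e he
              · simpa [List.mem_singleton.1 he] using hzb'.trans hbb'.le))
      exact ⟨E', y', by simpa using h₁, h₂⟩
    · refine ⟨E, z :: y, rfl, hE, ?_⟩
      have hEa : ∀ e ∈ E, e ≤ a := by
        rcases hE with rfl | ⟨b, -, hba, hEb⟩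
        · simp
        · exact fun e he => (hEb e he).trans hba.le
      rw [mem_sylvesterNormalForms_iff, List.triplewise_append] at h ⊢
      obtain ⟨h₁, h₂, h₃, h₄⟩ := h
      have hza : ∀ b ∈ y, z ≤ b → a ≤ b := fun b hb hzb => not_lt.1 fun hba => hz ⟨b, hb, hzb, hba⟩
      refine ⟨h₁, List.triplewise_cons.2 ⟨List.pairwise_cons.2 ⟨hza, ?_⟩, h₂⟩, fun e he => ?_, ?_⟩
      -- A bad triple starting with `a` would, through the triples starting with `z`, yield a `b`
      -- for which `a` should have passed `z`.
      · exact (List.triplewise_cons.1 h₂).1.imp_of_mem fun _ hb h' hyb => hza _ hb (h' hyb)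
      · exact List.pairwise_cons.2 ⟨fun b _ hab => (hEa e he).trans hab, h₃ e he⟩
      · refine List.forall_mem_cons.2 ⟨?_, h₄⟩
        exact List.pairwise_of_forall_mem_list fun x hx _ _ _ => hEa x hx

theorem exists_sylvesterStep_cons {u : List (Fin n)} (hu : u ∈ sylvesterNormalForms n)
    (a : Fin n) : ∃ v ∈ sylvesterNormalForms n, SylvesterStep (a :: u) v := by
  obtain ⟨E, y, rfl, hE, h⟩ := exists_insert_mem_sylvesterNormalForms a u [] hu (Or.inl rfl)
  refine ⟨_, h, ?_⟩
  rcases hE with rfl | ⟨b, hb, hba, hEb⟩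
  · exact SylvesterStep.refl _
  · obtain ⟨q, r, rfl⟩ := List.append_of_mem hb
    -- The slide moves `a` leftwards and is used in reverse here, which is why steps are symmetric.
    exact Or.inr (Or.inl ⟨(b, a), [], E, q, r,
      fun d hd => Or.inr (Or.inr ⟨hEb d hd, hba⟩), rfl, rfl⟩)

theorem exists_mem_sylvesterNormalForms (m : SylvesterMonoid n) :
    ∃ u ∈ sylvesterNormalForms n, wordEval (sylvesterGen n) u = m := by
  obtain ⟨w, rfl⟩ := PresentedMonoid.surjective_mk m
  suffices H : ∀ w : List (Fin n), ∃ u ∈ sylvesterNormalForms n,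
      wordEval (sylvesterGen n) u = wordEval (sylvesterGen n) w by
    obtain ⟨u, hu, h⟩ := H w.toList
    exact ⟨u, hu, by rw [h, wordEval_sylvesterGen]; rfl⟩
  intro w
  induction w with
  | nil => exact ⟨[], by simp [mem_sylvesterNormalForms_iff], rfl⟩
  | cons a w ih =>
    obtain ⟨u, hu, h⟩ := ih
    obtain ⟨v, hv, hS⟩ := exists_sylvesterStep_cons hu a
    exact ⟨v, hv, by rw [← wordEval_eq_of_sylvesterStep hS, wordEval_cons, wordEval_cons, h]⟩

end Sylvester

theorem mainTheorem7 (n : ℕ) :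
    IsBiautomaticStructure (sylvesterGen n) (sylvesterNormalForms n) := by
  refine isBiautomaticStructure_of_syncRegular (S := relPow SylvesterStep n)
    (PresentedMonoid.closure_range_of _) isRegular_sylvesterNormalForms
    exists_mem_sylvesterNormalForms (fun _ hu _ hv => eq_of_mem_sylvesterNormalForms hu hv)
    (fun _ _ => length_eq_of_wordEval_sylvesterGen_eq) (syncRegular_sylvesterStep.relPow n)
    (fun _ _ => wordEval_eq_of_relPow_sylvesterStep) (fun a u hu => ?_) (fun a u hu => ?_)
  · exact ⟨_, filter_append_filter_append_mem_sylvesterNormalForms hu a,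
      relPow_sylvesterStep_append_singleton hu a⟩
  · obtain ⟨v, hv, h⟩ := exists_sylvesterStep_cons hu a
    -- The letter `a` itself shows `1 ≤ n`, so one step can be padded to `n` by trivial steps.
    exact ⟨v, hv, relPow_mono SylvesterStep.refl (Nat.succ_le_of_lt a.pos) ⟨v, h, rfl⟩⟩
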